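/- Let $\mathcal H$ be a finite-dimensional complex Hilbert space, and let $\mathcal L(\mathcal H)$ be the space of linear operators on it. An observable is a map $\mathsf A:\Omega\to\mathcal L(\mathcal H)$ on a finite non-empty set $\Omega$ with every $\mathsf A(\omega)$ positive and $\sum_{\omega}\mathsf A(\omega)=\mathbb 1$; let $\mathcal O$ be the set of all observables on $\mathcal H$ (with arbitrary finite non-empty outcome sets). A channel is a completely positive trace-preserving linear map $\Lambda:\mathcal L(\mathcal H)\to\mathcal L(\mathcal K)$, where $\mathcal K$ is any finite-dimensional Hilbert space; let $\mathcal C$ be the collection of all channels. An observable $\mathsf A:\Omega\to\mathcal L(\mathcal H)$ and a channel $\Lambda:\mathcal L(\mathcal H)\to\mathcal L(\mathcal K)$ are compatible if there are completely positive maps $\mathcal I_\omega:\mathcal L(\mathcal H)\to\mathcal L(\mathcal K)$, $\omega\in\Omega$, such that $\sum_\omega\mathcal I_\omega=\Lambda$ and $\operatorname{tr}[T\mathsf A(\omega)]=\operatorname{tr}[\mathcal I_\omega(T)]$ for all $\omega\in\Omega$ and $T\in\mathcal L(\mathcal H)$. For $X\subseteq\mathcal O$ and $Y\subseteq\mathcal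 C$ let $\sigma_c(X)$ be the set of channels compatible with every observable in $X$, let $\tau_c(Y)$ be the set of observables compatible with every channel in $Y$, and let $\mathrm{leak}(X)=\tau_c(\sigma_c(X))$. For a stochastic matrix $\mu$ (nonnegative entries with $\sum_{\omega'}\mu(\omega',\omega)=1$ for every $\omega$) put $(\mu\circ\mathsf A)(\omega')=\sum_\omega\mu(\omega',\omega)\mathsf A(\omega)$, and write $\mathsf B\preccurlyeq\mathsf A$ if $\mathsf B=\mu\circ\mathsf A$ for some stochastic matrix $\mu$. Let $\mathrm{sim}_{\mathcal O}(X)$ be the set of observables of the form $\sum_{i=1}^n t_i\,\mu_i\circ\mathsf A_i$ with $\mathsf A_1,\dots,\mathsf A_n\in X$, stochastic matrices $\mu_i$, and $t_i\in[0,1]$, $\sum_i t_i=1$; write $\mathrm{sim}_{\mathcal O}(\mathsf A)=\mathrm{sim}_{\mathcal O}(\{\mathsf A\})$. Theorem. Let $X\subseteq\mathcal O$ have a greatest element, that is, there is $\mathsf A\in X$ such that $\mathsf B\preccurlyeq\mathsf A$ for every $\mathsf B\in X$. Then $$\mathrm{leak}(X)=\mathrm{sim}_{\mathcal O}(\mathsf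 A)=\{\mathsf B\in\mathcal O\mid\mathsf B\preccurlyeq\mathsf A\}.$$ -/

import Mathlib

open scoped CStarAlgebra

universe u v w

/-- An observable on the system with Hilbert space `H`: a finite (non-empty) outcome set `Ω` and
positive operators `effect x`, `x ∈ Ω`, that sum up to the identity operator. -/
structure Observable (H : Type u) [NormedAddCommGroup H] [InnerProductSpace ℂ H] where
  /-- The outcome set. -/
  Ω : Type v
  [fintypeΩ : Fintype Ω]
  [nonemptyΩ : Nonempty Ω]
  /-- The operator attached to an outcome. -/
  effect : Ω → (H →L[ℂ] H)
  effect_pos : ∀ x, (effect x).IsPositive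
  sum_effect : ∑ x, effect x = 1

attribute [instance] Observable.fintypeΩ Observable.nonemptyΩ

/-- The trace of an operator on a (finite-dimensional) Hilbert space. -/
noncomputable def opTrace {H : Type*} [NormedAddCommGroup H] [InnerProductSpace ℂ H]
    (T : H →L[ℂ] H) : ℂ :=
  LinearMap.trace ℂ H T.toLinearMap

/-- A channel with input system `H`: a finite-dimensional output Hilbert space `K` and a completely
positive trace preserving linear map `L(H) → L(K)`. (Completeness of `K` follows from finite
dimensionality; it is listed only to make the C⋆-algebra structure of `L(K)` available.) -/
structure Channel (H : Type u) [NormedAddCommGroup H] [InnerProductSpace ℂ H]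
    [CompleteSpace H] where
  /-- The output Hilbert space. -/
  K : Type w
  [normedK : NormedAddCommGroup K]
  [innerK : InnerProductSpace ℂ K]
  [finiteK : FiniteDimensional ℂ K]
  [completeK : CompleteSpace K]
  /-- The completely positive map. -/
  map : (H →L[ℂ] H) →CP (K →L[ℂ] K)
  trace_map : ∀ T, opTrace (map T) = opTrace T

attribute [instance] Channel.normedK Channel.innerK Channel.finiteK Channel.completeK

/-- An instrument with finite outcome set `Ω`, from `L(H)` to `L(K)`: a family of completely
positive maps whose sum is trace preserving, that is, a channel. -/
structure Instrument (Ω : Type*) [Fintype Ω]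
    (H : Type*) [NormedAddCommGroup H] [InnerProductSpace ℂ H] [CompleteSpace H]
    (K : Type*) [NormedAddCommGroup K] [InnerProductSpace ℂ K] [CompleteSpace K] where
  /-- The completely positive map attached to an outcome. -/
  op : Ω → ((H →L[ℂ] H) →CP (K →L[ℂ] K))
  trace_sum : ∀ T, opTrace (∑ x, op x T) = opTrace T

section

variable {H : Type u} [NormedAddCommGroup H] [InnerProductSpace ℂ H] [CompleteSpace H]

/-- The channel associated with the instrument `I` is `Λ`. -/
def Instrument.HasChannel {Ω : Type*} [Fintype Ω] {Λ : Channel.{u, w} H}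
    (I : Instrument Ω H Λ.K) : Prop :=
  ∀ T : H →L[ℂ] H, ∑ x, I.op x T = Λ.map T

/-- The observable associated with the instrument `I` is `A`. -/
def Instrument.HasObservable {K : Type*} [NormedAddCommGroup K] [InnerProductSpace ℂ K]
    [CompleteSpace K] {A : Observable.{u, v} H} (I : Instrument A.Ω H K) : Prop :=
  ∀ (x : A.Ω) (T : H →L[ℂ] H), opTrace (T * A.effect x) = opTrace (I.op x T)

/-- The observable `A` and the channel `Λ` are compatible. -/
def Compatible (A : Observable.{u, v} H) (Λ : Channel.{u, w} H) : Prop :=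
  ∃ I : Instrument A.Ω H Λ.K, I.HasChannel ∧ I.HasObservable

/-- `σ_c(X)`: the channels that are compatible with every observable in `X`. -/
def sigmaC (X : Set (Observable.{u, v} H)) : Set (Channel.{u, w} H) :=
  {Λ | ∀ A ∈ X, Compatible A Λ}

/-- `τ_c(Y)`: the observables that are compatible with every channel in `Y`. -/
def tauC (Y : Set (Channel.{u, w} H)) : Set (Observable.{u, v} H) :=
  {A | ∀ Λ ∈ Y, Compatible A Λ}

/-- The leak closure `τ_c σ_c`. -/
def leak (X : Set (Observable.{u, v} H)) : Set (Observable.{u, v} H) :=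
  tauC (sigmaC.{u, v, w} X)

end

/-- A stochastic matrix `μ(y, x)`: nonnegative, and every column (fixed `x`) sums up to `1`. -/
structure IsStochastic {Ω' Ω : Type*} [Fintype Ω'] (μ : Matrix Ω' Ω ℝ) : Prop where
  nonneg : ∀ y x, 0 ≤ μ y x
  sum_eq_one : ∀ x, ∑ y, μ y x = 1

section

variable {H : Type u} [NormedAddCommGroup H] [InnerProductSpace ℂ H]

/-- The post-processing `μ ∘ A`, as a family of operators. -/
noncomputable def postProcess {Ω' : Type*} (A : Observable.{u, v} H) (μ : Matrix Ω' A.Ω ℝ)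
    (y : Ω') : H →L[ℂ] H :=
  ∑ x, (μ y x : ℂ) • A.effect x

/-- The post-processing preorder: `PostProc B A` says that `B = μ ∘ A` for some stochastic
matrix `μ`. -/
def PostProc (B A : Observable.{u, v} H) : Prop :=
  ∃ μ : Matrix B.Ω A.Ω ℝ, IsStochastic μ ∧ ∀ y, B.effect y = postProcess A μ y

/-- `sim_O(X)`: the observables that are simulable by `X`, that is, are finite convex mixtures of
post-processings of observables in `X`. -/
def simO (X : Set (Observable.{u, v} H)) : Set (Observable.{u, v} H) :=
  {B | ∃ (n : ℕ) (A : Fin n → Observable.{u, v} H) (t : Fin n → ℝ)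
      (μ : (i : Fin n) → Matrix B.Ω (A i).Ω ℝ),
      (∀ i, A i ∈ X) ∧ (∀ i, t i ∈ Set.Icc (0 : ℝ) 1) ∧ ∑ i, t i = 1 ∧
      (∀ i, IsStochastic (μ i)) ∧
      ∀ y, B.effect y = ∑ i, (t i : ℂ) • postProcess (A i) (μ i) y}

end

/-!
The inclusion `{B | B ≼ A} ⊆ leak X` holds because the outcomes of an instrument can be
post-processed without changing its channel (`PostProc.compatible`).

For the converse it is enough to test against one channel, `Λ(T) = ⨁ₓ √A(x) T √A(x)`
(`ludersChannel`). It is compatible with `A`, hence with every element of `X`. Let `B` be compatible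
with `Λ`, by an instrument `J`. For a fixed outcome `x` of `A`, the compressions of the maps `J y` to
the block `x` are positive and add up to the pure operation `T ↦ √A(x) T √A(x)`. A pure operation
dominates only its own multiples (`exists_eq_mul_norm_inner_sq`), so the compression of `J y` is
`μ(y, x)` times that operation. Taking traces gives `B(y) = ∑ₓ μ(y, x) A(x)`
(`postProc_of_compatible_ludersChannel`). Only positivity of the maps `J y` enters here.

The domination argument works with the forms `⟨η, J(|φ⟩⟨φ|) η⟩`, which are Hermitian quadratic in `η`
and in `φ` separately; in either variable they are dominated by a rank-one form, hence are multiples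
of it, and comparing the two factors shows that they do not depend on `η` and `φ`.
-/

/-! ### Hermitian forms dominated by rank-one forms -/

section

variable {H : Type*} [NormedAddCommGroup H] [InnerProductSpace ℂ H]

/-- The real-valued functions `q u = B u u` of Hermitian sesquilinear forms `B`, characterised by
what is needed of them: along real lines `q` is quadratic with leading coefficient `q k`, and it is
homogeneous of degree two under complex scalars. -/
structure IsHermitianQuadratic (q : H → ℝ) : Prop where
  line : ∀ u k : H, ∃ b : ℝ, ∀ t : ℝ, q (u + (t : ℂ) • k) = q u + t * b + t ^ 2 * q k
  smul : ∀ (z : ℂ) (u : H), q (z • u) = ‖z‖ ^ 2 * q u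

lemma IsHermitianQuadratic.of_sesquilinear (B : H →ₗ[ℂ] H →ₗ⋆[ℂ] ℂ) :
    IsHermitianQuadratic fun u => (B u u).re where
  line u k := by
    refine ⟨(B u k).re + (B k u).re, fun t => ?_⟩
    simp only [map_add, LinearMap.add_apply, map_smul, map_smulₛₗ, LinearMap.smul_apply,
      smul_eq_mul, Complex.conj_ofReal, Complex.add_re, Complex.re_ofReal_mul]
    ring
  smul z u := by
    simp only [map_smul, map_smulₛₗ, LinearMap.smul_apply, smul_eq_mul]
    rw [← mul_assoc, Complex.conj_mul', ← Complex.ofReal_pow, Complex.re_ofReal_mul]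

/-- A nonnegative Hermitian form dominated by the rank-one form `u ↦ |⟨v, u⟩|²` is a multiple of
it. -/
lemma IsHermitianQuadratic.eq_mul_of_le_inner {q : H → ℝ} (hq : IsHermitianQuadratic q)
    (h0 : ∀ u, 0 ≤ q u) (v : H) (hv : ∀ u, q u ≤ ‖inner ℂ v u‖ ^ 2) :
    ∃ c : ℝ, 0 ≤ c ∧ ∀ u, q u = c * ‖inner ℂ v u‖ ^ 2 := by
  have key : ∀ u k, inner ℂ v k = 0 → q (u + k) = q u := by
    intro u k hk
    have hqk : q k = 0 := le_antisymm (by simpa [hk] using hv k) (h0 k)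
    obtain ⟨b, hb⟩ := hq.line u k
    have hlow : ∀ t : ℝ, 0 ≤ q u + t * b := fun t => by
      have := h0 (u + (t : ℂ) • k)
      rwa [hb t, hqk, mul_zero, add_zero] at this
    -- An affine function of `t` that is bounded below on all of `ℝ` is constant.
    have hb0 : b = 0 := by
      by_contra hne
      have := hlow (-(q u + 1) / b)
      rw [div_mul_cancel₀ _ hne] at this
      linarith
    simpa [hqk, hb0] using hb 1
  rcases eq_or_ne v 0 with rfl | hv0
  · exact ⟨0, le_rfl, fun u => le_antisymm (by simpa using hv u) (by simpa using h0 u)⟩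
  have hn : ‖v‖ ≠ 0 := norm_ne_zero_iff.mpr hv0
  have hn' : (‖v‖ : ℂ) ≠ 0 := by exact_mod_cast hn
  refine ⟨q v / ‖v‖ ^ 4, div_nonneg (h0 v) (by positivity), fun u => ?_⟩
  set z : ℂ := inner ℂ v u / (‖v‖ : ℂ) ^ 2 with hz
  have hk : inner ℂ v (u - z • v) = 0 := by
    rw [inner_sub_right, inner_smul_right, inner_self_eq_norm_sq_to_K, hz]
    simp [hn']
  have := key (z • v) (u - z • v) hk
  rw [add_sub_cancel, hq.smul] at this
  rw [this, hz, norm_div, norm_pow, Complex.norm_real, norm_norm]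
  field_simp

/-- A nonnegative form that is Hermitian quadratic in each of two variables and dominated by
`|⟨η, S φ⟩|²` is a multiple of it. With `Q η φ = ⟨η, F(|φ⟩⟨φ|) η⟩` this says that the pure operation
`T ↦ S T S†` dominates only its own multiples. -/
lemma exists_eq_mul_norm_inner_sq [CompleteSpace H] (S : H →L[ℂ] H) (Q : H → H → ℝ)
    (hleft : ∀ φ, IsHermitianQuadratic fun η => Q η φ)
    (hright : ∀ η, IsHermitianQuadratic (Q η))
    (h0 : ∀ η φ, 0 ≤ Q η φ) (hS : ∀ η φ, Q η φ ≤ ‖inner ℂ η (S φ)‖ ^ 2) :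
    ∃ c : ℝ, 0 ≤ c ∧ ∀ η φ, Q η φ = c * ‖inner ℂ η (S φ)‖ ^ 2 := by
  have hr : ∀ η, ∃ c : ℝ, 0 ≤ c ∧ ∀ φ, Q η φ = c * ‖inner ℂ η (S φ)‖ ^ 2 := fun η => by
    simpa only [ContinuousLinearMap.adjoint_inner_left] using
      (hright η).eq_mul_of_le_inner (h0 η) (S.adjoint η)
        (by simpa only [ContinuousLinearMap.adjoint_inner_left] using hS η)
  have hl : ∀ φ, ∃ d : ℝ, 0 ≤ d ∧ ∀ η, Q η φ = d * ‖inner ℂ η (S φ)‖ ^ 2 := fun φ => by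
    simpa only [norm_inner_symm (S φ)] using
      (hleft φ).eq_mul_of_le_inner (fun η => h0 η φ) (S φ)
        (fun η => by simpa only [norm_inner_symm (S φ)] using hS η φ)
  -- Where `⟨η, S φ⟩ ≠ 0` the factor `c η = d φ` of `|⟨η, S φ⟩|²` is independent of `φ` and of
  -- `η`; it remains to link any two such pairs by changing one entry at a time.
  choose c hc0 hc using hr
  choose d hd0 hd using hl
  have hcd : ∀ η φ, inner ℂ η (S φ) ≠ 0 → c η = d φ := fun η φ h =>
    mul_right_cancel₀ (pow_ne_zero 2 (norm_ne_zero_iff.mpr h)) ((hc η φ).symm.trans (hd φ η))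
  by_cases hex : ∃ η₀ φ₀, inner ℂ η₀ (S φ₀) ≠ 0
  · obtain ⟨η₀, φ₀, h₀⟩ := hex
    refine ⟨c η₀, hc0 η₀, fun η φ => ?_⟩
    by_cases h : inner ℂ η (S φ) = 0
    · simp [hc η φ, h]
    rw [hc η φ, hcd η φ h, hcd η₀ φ₀ h₀]
    congr 1
    by_cases h1 : inner ℂ η₀ (S φ) = 0
    · by_cases h2 : inner ℂ η (S φ₀) = 0
      · -- Neither of `η₀`, `η` links `φ` to `φ₀`, but their sum does.
        rw [← hcd (η₀ + η) φ (by simpa [inner_add_left, h1] using h),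
          ← hcd (η₀ + η) φ₀ (by simpa [inner_add_left, h2] using h₀)]
      · rw [← hcd η φ h, hcd η φ₀ h2]
    · rw [← hcd η₀ φ h1, hcd η₀ φ₀ h₀]
  · push Not at hex
    exact ⟨0, le_rfl, fun η φ => by simp [hc η φ, hex η φ]⟩

lemma isHermitianQuadratic_inner_map (P : H →L[ℂ] H) :
    IsHermitianQuadratic fun η => (inner ℂ η (P η)).re := by
  have := IsHermitianQuadratic.of_sesquilinear
    (LinearMap.mk₂'ₛₗ (RingHom.id ℂ) (starRingEnd ℂ) (fun x y : H => inner ℂ y (P x))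
      (fun _ _ _ => by simp) (fun _ _ _ => by simp)
      (fun _ _ _ => by simp) (fun _ _ _ => by simp [mul_comm]))
  simpa using this

lemma isHermitianQuadratic_rankOne (L : (H →L[ℂ] H) →ₗ[ℂ] ℂ) :
    IsHermitianQuadratic fun φ => (L (InnerProductSpace.rankOne ℂ φ φ)).re := by
  have := IsHermitianQuadratic.of_sesquilinear
    (LinearMap.mk₂'ₛₗ (RingHom.id ℂ) (starRingEnd ℂ)
      (fun x y : H => L (InnerProductSpace.rankOne ℂ x y))
      (fun _ _ _ => by simp) (fun _ _ _ => by simp)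
      (fun _ _ _ => by simp) (fun _ _ _ => by simp))
  simpa using this

end

/-! ### Completely positive maps -/

section

variable {H K : Type*} [NormedAddCommGroup H] [InnerProductSpace ℂ H] [CompleteSpace H]
  [NormedAddCommGroup K] [InnerProductSpace ℂ K] [CompleteSpace K]

/-- The sum `∑ i, t i • Φ i` of completely positive maps with nonnegative weights. -/
noncomputable def weightedSumCP {ι : Type*} [Fintype ι] (t : ι → ℝ) (ht : ∀ i, 0 ≤ t i)
    (Φ : ι → ((H →L[ℂ] H) →CP (K →L[ℂ] K))) : (H →L[ℂ] H) →CP (K →L[ℂ] K) where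
  toLinearMap := ∑ i, (t i : ℂ) • (Φ i).toLinearMap
  map_cstarMatrix_nonneg' k M hM := by
    have hsum : M.map ⇑(∑ i, (t i : ℂ) • (Φ i).toLinearMap) =
        ∑ i, t i • M.map (Φ i) := by
      have happ : ∀ (s : Finset ι) (f : ι → CStarMatrix (Fin k) (Fin k) (K →L[ℂ] K)) (i j),
          (∑ x ∈ s, f x) i j = ∑ x ∈ s, f x i j := fun s f i j => by
        classical
        induction s using Finset.induction_on with
        | empty => rfl
        | insert a s ha ih => rw [Finset.sum_insert ha, Finset.sum_insert ha, ← ih]; rfl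
      ext i j : 2
      rw [happ]
      simp only [CStarMatrix.map_apply, CStarMatrix.smul_apply, LinearMap.sum_apply,
        LinearMap.smul_apply, Complex.coe_smul]
      rfl
    rw [hsum]
    exact Finset.sum_nonneg fun i _ => smul_nonneg (ht i) ((Φ i).map_cstarMatrix_nonneg M hM)

@[simp]
lemma weightedSumCP_apply {ι : Type*} [Fintype ι] (t : ι → ℝ) (ht : ∀ i, 0 ≤ t i)
    (Φ : ι → ((H →L[ℂ] H) →CP (K →L[ℂ] K))) (T : H →L[ℂ] H) :
    weightedSumCP t ht Φ T = ∑ i, (t i : ℂ) • Φ i T := by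
  change (∑ i, (t i : ℂ) • (Φ i).toLinearMap) T = _
  simp
  rfl

open ContinuousLinearMap in
/-- The completely positive map `T ↦ V a T a† V†`. The isometry `V` and the operator `a` are kept
apart so that a factorisation `M = N† N` of a matrix of operators on `H` is carried to one of
operators on `K`, using `V† V = 1`. -/
noncomputable def conjCP (a : H →L[ℂ] H) (V : H →L[ℂ] K) (hV : V.adjoint ∘L V = 1) :
    (H →L[ℂ] H) →CP (K →L[ℂ] K) where
  toFun T := V ∘L (a * T * a.adjoint) ∘L V.adjoint
  map_add' S T := by simp [mul_add, add_mul]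
  map_smul' z T := by simp
  map_cstarMatrix_nonneg' k M hM := by
    rw [StarOrderedRing.nonneg_iff] at hM
    induction hM using AddSubmonoid.closure_induction with
    | mem _ h =>
      obtain ⟨N, rfl⟩ := h
      convert! star_mul_self_nonneg (N.map fun T => V ∘L (T * a.adjoint) ∘L V.adjoint) using 1
      ext i j ξ
      have hV' : ∀ x, V.adjoint (V x) = x := fun x => by simpa using congr($hV x)
      change (V ∘L (a * (star N * N) i j * a.adjoint) ∘L V.adjoint) ξ = _
      simp only [CStarMatrix.map_apply, CStarMatrix.mul_apply, CStarMatrix.star_apply]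
      simp [star_eq_adjoint, adjoint_comp, mul_def, hV']
    | zero =>
      convert! le_refl (0 : CStarMatrix (Fin k) (Fin k) (K →L[ℂ] K)) using 1
      ext i j : 2
      simp
    | add M N _ _ hM hN =>
      convert! add_nonneg hM hN using 1
      ext i j : 2
      simp [mul_add, add_mul]

lemma conjCP_apply (a : H →L[ℂ] H) (V : H →L[ℂ] K) (hV : V.adjoint ∘L V = 1) (T : H →L[ℂ] H) :
    conjCP a V hV T = V ∘L (a * T * a.adjoint) ∘L V.adjoint := rfl

end

open ContinuousLinearMap InnerProductSpace

/-! ### Orthogonal blocks -/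

section

variable {H K : Type*} [NormedAddCommGroup H] [InnerProductSpace ℂ H]
  [NormedAddCommGroup K] [InnerProductSpace ℂ K]
  {Ω κ : Type*} [Fintype Ω] [Fintype κ]

/-- The isometric embedding of `H` onto the block `x` of `K`, where an orthonormal basis of `K`
indexed by `Ω × κ` exhibits `K` as an orthogonal sum of copies of `H`, one for each `x : Ω`. -/
noncomputable def blockEmbedding (b : OrthonormalBasis κ ℂ H) (f : OrthonormalBasis (Ω × κ) ℂ K)
    (x : Ω) : H →L[ℂ] K :=
  ∑ i, rankOne ℂ (f (x, i)) (b i)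

variable (b : OrthonormalBasis κ ℂ H) (f : OrthonormalBasis (Ω × κ) ℂ K)

lemma blockEmbedding_basis (x : Ω) (i : κ) : blockEmbedding b f x (b i) = f (x, i) := by
  classical
  simp [blockEmbedding, sum_apply, orthonormal_iff_ite.mp b.orthonormal]

variable [CompleteSpace H] [CompleteSpace K]

lemma adjoint_blockEmbedding_comp_self (x : Ω) :
    (blockEmbedding b f x).adjoint ∘L blockEmbedding b f x = 1 := by
  classical
  rw [one_def, ← b.sum_rankOne_eq_id]
  simp [blockEmbedding, finsetSum_comp, comp_finsetSum, rankOne_comp_rankOne,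
    orthonormal_iff_ite.mp f.orthonormal]

lemma adjoint_blockEmbedding_comp_of_ne {x y : Ω} (hxy : x ≠ y) :
    (blockEmbedding b f x).adjoint ∘L blockEmbedding b f y = 0 := by
  classical
  simp [blockEmbedding, finsetSum_comp, comp_finsetSum, rankOne_comp_rankOne,
    orthonormal_iff_ite.mp f.orthonormal, hxy]

end

/-! ### Traces and post-processings -/

lemma opTrace_sum {H ι : Type*} [NormedAddCommGroup H] [InnerProductSpace ℂ H] (s : Finset ι)
    (T : ι → H →L[ℂ] H) : opTrace (∑ i ∈ s, T i) = ∑ i ∈ s, opTrace (T i) := by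
  simp [opTrace, toLinearMap_sum]

lemma opTrace_smul {H : Type*} [NormedAddCommGroup H] [InnerProductSpace ℂ H] (z : ℂ)
    (T : H →L[ℂ] H) : opTrace (z • T) = z * opTrace T := by
  simp [opTrace]

lemma opTrace_comp_comm {H K : Type*} [NormedAddCommGroup H] [InnerProductSpace ℂ H]
    [FiniteDimensional ℂ H] [NormedAddCommGroup K] [InnerProductSpace ℂ K] [FiniteDimensional ℂ K]
    (S : H →L[ℂ] K) (T : K →L[ℂ] H) : opTrace (S ∘L T) = opTrace (T ∘L S) :=
  LinearMap.trace_comp_comm' _ _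

section

variable {H : Type u} [NormedAddCommGroup H] [InnerProductSpace ℂ H]

lemma eq_of_re_inner_eq {S T : H →L[ℂ] H} (hS : S.IsPositive) (hT : T.IsPositive)
    (h : ∀ φ, (inner ℂ (S φ) φ).re = (inner ℂ (T φ) φ).re) : S = T := by
  refine ContinuousLinearMap.coe_injective ((ext_inner_map _ _).mp fun φ => ?_)
  exact Complex.ext (h φ) (((Complex.nonneg_iff.mp (hS.inner_nonneg_left φ)).2).symm.trans
    (Complex.nonneg_iff.mp (hT.inner_nonneg_left φ)).2)

lemma postProcess_isPositive {Ω' : Type*} [Fintype Ω'] (A : Observable.{u, v} H)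
    {μ : Matrix Ω' A.Ω ℝ} (hμ : IsStochastic μ) (y : Ω') : (postProcess A μ y).IsPositive :=
  isPositive_sum _ fun x _ => (A.effect_pos x).smul_of_nonneg (by exact_mod_cast hμ.nonneg y x)

/-- A mixture of post-processings of one observable is its post-processing by the mixture of the
stochastic matrices. -/
lemma simO_singleton (A : Observable.{u, v} H) : simO {A} = {B | PostProc B A} := by
  ext B
  constructor
  · rintro ⟨n, A', t, μ, hA', ht, hsum, hμ, hB⟩
    obtain rfl : A' = fun _ => A := funext hA'
    refine ⟨fun y x => ∑ i, t i * μ i y x, ⟨fun y x => ?_, fun x => ?_⟩, fun y => ?_⟩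
    · exact Finset.sum_nonneg fun i _ => mul_nonneg (ht i).1 ((hμ i).nonneg y x)
    · rw [Finset.sum_comm]
      simp only [← Finset.mul_sum, (hμ _).sum_eq_one, mul_one, hsum]
    · rw [hB]
      simp only [postProcess, Finset.smul_sum, smul_smul, Complex.ofReal_sum, Complex.ofReal_mul,
        Finset.sum_smul]
      exact Finset.sum_comm
  · rintro ⟨μ, hμ, hB⟩
    exact ⟨1, fun _ => A, fun _ => 1, fun _ => μ, by simp, by simp, by simp, fun _ => hμ,
      by simpa using hB⟩

end

section

variable {H : Type u} [NormedAddCommGroup H] [InnerProductSpace ℂ H] [CompleteSpace H]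

/-- Post-processing the outcomes of an instrument leaves its channel unchanged, so that
compatibility with a channel passes down along the post-processing preorder. -/
lemma PostProc.compatible {A B : Observable.{u, v} H} {Λ : Channel.{u, w} H}
    (hBA : PostProc B A) (hA : Compatible A Λ) : Compatible B Λ := by
  obtain ⟨μ, hμ, hB⟩ := hBA
  obtain ⟨I, hI, hIA⟩ := hA
  have hsum : ∀ T, ∑ y, weightedSumCP (μ y) (hμ.nonneg y) I.op T = Λ.map T := fun T => by
    simp only [weightedSumCP_apply]
    rw [Finset.sum_comm, ← hI T]
    refine Finset.sum_congr rfl fun x _ => ?_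
    rw [← Finset.sum_smul, ← Complex.ofReal_sum, hμ.sum_eq_one, Complex.ofReal_one, one_smul]
  refine ⟨⟨fun y => weightedSumCP (μ y) (hμ.nonneg y) I.op, fun T => ?_⟩, hsum, fun y T => ?_⟩
  · rw [hsum, Λ.trace_map]
  · simp only [weightedSumCP_apply, opTrace_sum, opTrace_smul, hB, postProcess,
      Finset.mul_sum, mul_smul_comm, hIA _ T]

/-! ### The Lüders channel with recorded outcome -/

lemma Observable.sqrt_mul_sqrt (A : Observable.{u, v} H) (x : A.Ω) :
    CFC.sqrt (A.effect x) * CFC.sqrt (A.effect x) = A.effect x :=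
  CFC.sqrt_mul_sqrt_self _ ((nonneg_iff_isPositive _).mpr (A.effect_pos x))

lemma Observable.adjoint_sqrt (A : Observable.{u, v} H) (x : A.Ω) :
    (CFC.sqrt (A.effect x)).adjoint = CFC.sqrt (A.effect x) := by
  have h : (CFC.sqrt (A.effect x)).IsPositive :=
    (nonneg_iff_isPositive _).mp (CFC.sqrt_nonneg (A.effect x))
  exact h.isSelfAdjoint.adjoint_eq

lemma Observable.norm_sqrt_sq (A : Observable.{u, v} H) (x : A.Ω) (φ : H) :
    ‖CFC.sqrt (A.effect x) φ‖ ^ 2 = (inner ℂ (A.effect x φ) φ).re := by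
  conv_rhs => rw [← A.sqrt_mul_sqrt x, mul_def, comp_apply, ← A.adjoint_sqrt x, adjoint_inner_left,
    A.adjoint_sqrt x]
  exact (inner_self_eq_norm_sq (𝕜 := ℂ) _).symm

variable {κ : Type*} [Fintype κ] {K : Type w} [NormedAddCommGroup K] [InnerProductSpace ℂ K]
  [CompleteSpace K]

/-- The Lüders operation `T ↦ √A(x) T √A(x)`, with its output placed in the block `x` of `K`. -/
noncomputable def ludersCP (A : Observable.{u, v} H) (b : OrthonormalBasis κ ℂ H)
    (f : OrthonormalBasis (A.Ω × κ) ℂ K) (x : A.Ω) : (H →L[ℂ] H) →CP (K →L[ℂ] K) :=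
  conjCP (CFC.sqrt (A.effect x)) (blockEmbedding b f x) (adjoint_blockEmbedding_comp_self b f x)

lemma re_inner_sum_ludersCP (A : Observable.{u, v} H) (b : OrthonormalBasis κ ℂ H)
    (f : OrthonormalBasis (A.Ω × κ) ℂ K) (x : A.Ω) (η φ : H) :
    (inner ℂ (blockEmbedding b f x η)
      ((∑ x', ludersCP A b f x' (rankOne ℂ φ φ)) (blockEmbedding b f x η))).re =
    ‖inner ℂ η (CFC.sqrt (A.effect x) φ)‖ ^ 2 := by
  have hself : (blockEmbedding b f x).adjoint (blockEmbedding b f x η) = η :=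
    congr($(adjoint_blockEmbedding_comp_self b f x) η)
  rw [sum_apply, inner_sum, Finset.sum_eq_single x]
  · rw [ludersCP, conjCP_apply, comp_apply, comp_apply, hself, ← adjoint_inner_left, hself,
      mul_def, mul_def, comp_apply, comp_apply, rankOne_apply, map_smul, inner_smul_right,
      adjoint_inner_right]
    rw [← inner_conj_symm, Complex.conj_mul', ← Complex.ofReal_pow, Complex.ofReal_re]
  · intro y _ hy
    have hne : (blockEmbedding b f y).adjoint (blockEmbedding b f x η) = 0 :=
      congr($(adjoint_blockEmbedding_comp_of_ne b f hy) η)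
    simp [ludersCP, conjCP_apply, hne]
  · simp

variable [FiniteDimensional ℂ H] [FiniteDimensional ℂ K]

lemma opTrace_ludersCP (A : Observable.{u, v} H) (b : OrthonormalBasis κ ℂ H)
    (f : OrthonormalBasis (A.Ω × κ) ℂ K) (x : A.Ω) (T : H →L[ℂ] H) :
    opTrace (ludersCP A b f x T) = opTrace (T * A.effect x) := by
  rw [ludersCP, conjCP_apply, opTrace_comp_comm, comp_assoc, adjoint_blockEmbedding_comp_self,
    A.adjoint_sqrt, one_def, comp_id, mul_assoc, mul_def, opTrace_comp_comm, ← mul_def,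
    mul_assoc, A.sqrt_mul_sqrt]

/-- The channel `T ↦ ⨁ₓ √A(x) T √A(x)`, that is, the Lüders instrument of `A` whose outcome is
recorded in the output system. -/
noncomputable def ludersChannel (A : Observable.{u, v} H) (b : OrthonormalBasis κ ℂ H)
    (f : OrthonormalBasis (A.Ω × κ) ℂ K) : Channel.{u, w} H where
  K := K
  map := weightedSumCP (fun _ => 1) (fun _ => zero_le_one) (ludersCP A b f)
  trace_map T := by
    simp only [weightedSumCP_apply, Complex.ofReal_one, one_smul, opTrace_sum, opTrace_ludersCP]
    rw [← opTrace_sum, ← Finset.mul_sum, A.sum_effect, mul_one]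

lemma ludersChannel_map (A : Observable.{u, v} H) (b : OrthonormalBasis κ ℂ H)
    (f : OrthonormalBasis (A.Ω × κ) ℂ K) (T : H →L[ℂ] H) :
    (ludersChannel A b f).map T = ∑ x, ludersCP A b f x T := by
  change weightedSumCP (fun _ => 1) (fun _ => zero_le_one) (ludersCP A b f) T = _
  simp only [weightedSumCP_apply, Complex.ofReal_one, one_smul]

lemma compatible_ludersChannel (A : Observable.{u, v} H) (b : OrthonormalBasis κ ℂ H)
    (f : OrthonormalBasis (A.Ω × κ) ℂ K) : Compatible A (ludersChannel A b f) := by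
  refine ⟨⟨ludersCP A b f, fun T => ?_⟩, fun T => (ludersChannel_map A b f T).symm,
    fun x T => (opTrace_ludersCP A b f x T).symm⟩
  exact (congrArg opTrace (ludersChannel_map A b f T)).symm.trans
    ((ludersChannel A b f).trace_map T)

/-- The observables compatible with the Lüders channel of `A` are post-processings of `A`: each
block of the channel is a pure operation, so an instrument of the channel can only split it into
multiples of itself, and the factors form the stochastic matrix. -/
lemma postProc_of_compatible_ludersChannel {A B : Observable.{u, v} H} (b : OrthonormalBasis κ ℂ H)
    (f : OrthonormalBasis (A.Ω × κ) ℂ K) (hB : Compatible B (ludersChannel A b f)) :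
    PostProc B A := by
  obtain ⟨⟨J, hJtr⟩, hJ, hJB⟩ := hB
  change B.Ω → ((H →L[ℂ] H) →CP (K →L[ℂ] K)) at J
  replace hJ : ∀ T, ∑ y, J y T = ∑ x, ludersCP A b f x T := fun T =>
    (hJ T).trans (ludersChannel_map A b f T)
  let a : A.Ω → H →L[ℂ] H := fun x => CFC.sqrt (A.effect x)
  let V : A.Ω → H →L[ℂ] K := blockEmbedding b f
  let Q : B.Ω → A.Ω → H → H → ℝ := fun y x η φ =>
    (inner ℂ (V x η) (J y (rankOne ℂ φ φ) (V x η))).re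
  have h0 : ∀ y x η φ, 0 ≤ Q y x η φ := fun y x η φ => by
    have h : 0 ≤ J y (rankOne ℂ φ φ) := by
      rw [← map_zero (J y)]
      exact OrderHomClass.mono (J y) ((nonneg_iff_isPositive _).mpr (isPositive_rankOne_self φ))
    exact ((nonneg_iff_isPositive _).mp h).re_inner_nonneg_right _
  have hsum : ∀ x η φ, ∑ y, Q y x η φ = ‖inner ℂ η (a x φ)‖ ^ 2 := fun x η φ => by
    rw [← re_inner_sum_ludersCP A b f, ← hJ, sum_apply, inner_sum, Complex.re_sum]
  have hQ : ∀ y x, ∃ c : ℝ, 0 ≤ c ∧ ∀ η φ, Q y x η φ = c * ‖inner ℂ η (a x φ)‖ ^ 2 :=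
    fun y x => by
      refine exists_eq_mul_norm_inner_sq (a x) (Q y x) (fun φ => ?_) (fun η => ?_) (h0 y x)
        fun η φ => ?_
      · have := isHermitianQuadratic_inner_map ((V x).adjoint ∘L J y (rankOne ℂ φ φ) ∘L V x)
        simpa [adjoint_inner_right] using this
      · exact isHermitianQuadratic_rankOne ((innerSL ℂ (V x η)).toLinearMap ∘ₗ
          (ContinuousLinearMap.apply ℂ K (V x η)).toLinearMap ∘ₗ (J y).toLinearMap)
      · rw [← hsum]
        exact Finset.single_le_sum (f := fun y => Q y x η φ) (fun y _ => h0 y x η φ)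
          (Finset.mem_univ y)
  choose c hc0 hc using hQ
  classical
  -- If `√A(x) = 0`, then `c · x` is arbitrary; the uniform column makes the matrix stochastic.
  let μ : Matrix B.Ω A.Ω ℝ := fun y x => if a x = 0 then (Fintype.card B.Ω : ℝ)⁻¹ else c y x
  have hQμ : ∀ y x η φ, Q y x η φ = μ y x * ‖inner ℂ η (a x φ)‖ ^ 2 := fun y x η φ => by
    by_cases h : a x = 0
    · simp [hc, h]
    · simp [hc, μ, h]
  have hμ : IsStochastic μ := by
    refine ⟨fun y x => ?_, fun x => ?_⟩
    · by_cases h : a x = 0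
      · simp [μ, h]
      · simpa [μ, h] using hc0 y x
    · by_cases h : a x = 0
      · simp [μ, h]
      obtain ⟨φ, hφ⟩ : ∃ φ, a x φ ≠ 0 := by
        by_contra! h'
        exact h (ContinuousLinearMap.ext h')
      have hpos : ‖inner ℂ (a x φ) (a x φ)‖ ^ 2 ≠ 0 := by simpa using hφ
      refine mul_right_cancel₀ hpos ?_
      rw [Finset.sum_mul, one_mul]
      refine Eq.trans ?_ (hsum x _ φ)
      exact Finset.sum_congr rfl fun y _ => (hQμ y x _ φ).symm
  refine ⟨μ, hμ, fun y => eq_of_re_inner_eq (B.effect_pos y) (postProcess_isPositive A hμ y)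
    fun φ => ?_⟩
  have htr : (inner ℂ (B.effect y φ) φ).re = ∑ x, ∑ i, Q y x (b i) φ := by
    have h1 : inner ℂ (B.effect y φ) φ = opTrace (rankOne ℂ φ φ * B.effect y) := by
      rw [mul_def, rankOne_comp, opTrace, trace_rankOne,
        (B.effect_pos y).isSelfAdjoint.adjoint_eq]
    -- The basis `f` consists of the images of `b` in the blocks, so the trace splits over blocks.
    have h2 : opTrace (J y (rankOne ℂ φ φ)) =
        ∑ p, inner ℂ (f p) (J y (rankOne ℂ φ φ) (f p)) :=
      LinearMap.trace_eq_sum_inner _ f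
    rw [h1, hJB y]
    refine (congrArg Complex.re h2).trans ?_
    rw [Fintype.sum_prod_type, Complex.re_sum]
    simp only [Complex.re_sum, Q, V, blockEmbedding_basis]
  rw [htr]
  simp only [hQμ, ← Finset.mul_sum, b.sum_sq_norm_inner_right, a, A.norm_sqrt_sq, postProcess,
    sum_apply, sum_inner, Complex.re_sum]
  refine Finset.sum_congr rfl fun x _ => ?_
  rw [smul_apply, inner_smul_left, Complex.conj_ofReal, Complex.re_ofReal_mul]

end

theorem theorem3 {H : Type u} [NormedAddCommGroup H] [InnerProductSpace ℂ H]
    [FiniteDimensional ℂ H] [CompleteSpace H]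
    (X : Set (Observable.{u, v} H)) (A : Observable.{u, v} H)
    (hA : A ∈ X) (hgreatest : ∀ B ∈ X, PostProc B A) :
    leak.{u, v, w} X = simO {A} ∧ simO {A} = {B | PostProc B A} := by
  refine ⟨?_, simO_singleton A⟩
  rw [simO_singleton]
  ext B
  refine ⟨fun hB => ?_, fun hB Λ hΛ => hB.compatible (hΛ A hA)⟩
  -- The outcome set lives in the universe `v`, so the output space `K : Type w` is built on a copy
  -- of `Fin m`.
  let b := stdOrthonormalBasis ℂ H
  let e : ULift.{w} (Fin (Fintype.card (A.Ω × Fin (Module.finrank ℂ H)))) ≃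
      A.Ω × Fin (Module.finrank ℂ H) := Equiv.ulift.trans (Fintype.equivFin _).symm
  let f := (EuclideanSpace.basisFun _ ℂ).reindex e
  exact postProc_of_compatible_ludersChannel b f <| hB _ fun C hC =>
    (hgreatest C hC).compatible (compatible_ludersChannel A b f)
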